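/- Let $n,m,p\in\mathbb N$, $0\le \ell\le p$, $I=\{1,\dots,\ell\}$, $J=\{\ell+1,\dots,p\}$, and let $f,h_1,\dots,h_p\colon\mathbb R^n\times\mathbb R^m\to\mathbb R$ be continuously differentiable, where $\mathbb R^n$ and $\mathbb R^m$ carry the Euclidean norm. For $x\in\mathbb R^n$ put $$\Gamma(x)=\{y\in\mathbb R^m : h_i(x,y)\le 0\ (i\in I),\ h_i(x,y)=0\ (i\in J)\},\qquad \operatorname{dom}\Gamma=\{x:\Gamma(x)\neq\varnothing\},$$ $$\varphi(x)=\inf\{f(x,y): y\in\Gamma(x)\}\in[-\infty,\infty],\qquad S(x)=\operatorname{argmin}\{f(x,y): y\in\Gamma(x)\},$$ with $\inf\varnothing=\infty$. For $y\in\Gamma(x)$ let $I(x,y)=\{i\in I: h_i(x,y)=0\}$. A pair of finite families $((a^i)_{i\in I_1},(b^i)_{i\in I_2})$ of vectors is *positive-linearly dependent* if there are scalars $\alpha_i\ge0$ $(i\in I_1)$ and $\beta_i\in\mathbb R$ $(i\in I_2)$, not all zero, with $\sum_{i\in I_1}\alpha_ia^i+\sum_{i\in I_2}\beta_ib^i=0$.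 For $\bar y\in\Gamma(\bar x)$, *$\mathrm{RCPLD}_\Gamma$ holds at* $(\bar x,\bar y)$ if there are a neighborhood $U$ of $(\bar x,\bar y)$ and a set $T\subset J$ such that (i) the family $(\nabla_yh_i(\bar x,\bar y))_{i\in T}$ is a basis of the span of $\{\nabla_yh_i(\bar x,\bar y): i\in J\}$; (ii) the family $(\nabla_yh_i(x,y))_{i\in J}$ has constant rank for $(x,y)\in U$; (iii) for each $K\subset I(\bar x,\bar y)$ such that $\bigl((\nabla_yh_i(\bar x,\bar y))_{i\in K},(\nabla_yh_i(\bar x,\bar y))_{i\in T}\bigr)$ is positive-linearly dependent, the family $(\nabla_yh_i(x,y))_{i\in K\cup T}$ is linearly dependent for every $(x,y)\in U$. $S$ is *inner semicontinuous* at $(\bar x,\bar y)$, where $\bar y\in S(\bar x)$, if for every sequence $x^k\to\bar x$ there is a sequence $y^k\to\bar y$ with $y^k\in S(x^k)$ for all sufficiently large $k$. Let $\bar x\in\operatorname{dom}\Gamma$, and suppose that at least one of the following holds. (a) For every $x\in\mathbb R^n$ the functions $h_i(x,\cdot)$, $i\in I$, are convex and the functions $h_i(x,\cdot)$, $i\in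 J$, are affine; there are a bounded set $B\subset\mathbb R^m$ and a neighborhood $V$ of $\bar x$ with $\Gamma(x)\subset B$ for all $x\in V$; $\mathrm{RCPLD}_\Gamma$ holds at each point of $\{\bar x\}\times\Gamma(\bar x)$; and $\bar x$ is an interior point of $\operatorname{dom}\Gamma$. (b) There is $\bar y\in S(\bar x)$ such that $S$ is inner semicontinuous at $(\bar x,\bar y)$ and $\mathrm{RCPLD}_\Gamma$ holds at $(\bar x,\bar y)$. Then $\varphi$ is locally Lipschitz continuous at $\bar x$: there are $\delta>0$ and $L>0$ such that $\varphi$ is finite on the open ball of radius $\delta$ around $\bar x$ and $|\varphi(x)-\varphi(x')|\le L\|x-x'\|$ for all $x,x'$ in that ball. -/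

import Mathlib

open Filter Topology

namespace ParamOpt

/-- `ℝⁿ` with the Euclidean norm. -/
abbrev E (n : ℕ) : Type := EuclideanSpace ℝ (Fin n)

/-- The inequality indices: the first `ℓ` of the `p` constraints. -/
def ineqIdx (p ℓ : ℕ) : Finset (Fin p) := Finset.univ.filter fun i => i.val < ℓ

/-- The equality indices: the remaining constraints. -/
def eqIdx (p ℓ : ℕ) : Finset (Fin p) := Finset.univ.filter fun i => ℓ ≤ i.val

/-- The domain of a set-valued mapping. -/
def dom {n m : ℕ} (Υ : E n → Set (E m)) : Set (E n) := {x | (Υ x).Nonempty}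

/-- Local boundedness of a set-valued mapping at a point. -/
def LocallyBoundedAt {n m : ℕ} (Υ : E n → Set (E m)) (xbar : E n) : Prop :=
  ∃ B : Set (E m), Bornology.IsBounded B ∧ ∃ U ∈ 𝓝 xbar, ∀ x ∈ U, Υ x ⊆ B

/-- Inner semicontinuity of a set-valued mapping at a point of its graph. -/
def InnerSemicontinuousAt {n m : ℕ} (Υ : E n → Set (E m)) (xbar : E n) (ybar : E m) : Prop :=
  ybar ∈ Υ xbar ∧
    ∀ x : ℕ → E n, Tendsto x atTop (𝓝 xbar) →
      ∃ y : ℕ → E m, Tendsto y atTop (𝓝 ybar) ∧ ∀ᶠ k in atTop, y k ∈ Υ (x k)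

/-- Local Lipschitz continuity at a point of an extended-real-valued function: the function is
finite near the point and Lipschitz there. -/
def LocallyLipschitzAt {n : ℕ} (φ : E n → EReal) (xbar : E n) : Prop :=
  ∃ δ : ℝ, 0 < δ ∧ ∃ L : ℝ, 0 < L ∧
    (∀ x ∈ Metric.ball xbar δ, φ x ≠ ⊥ ∧ φ x ≠ ⊤) ∧
    ∀ x ∈ Metric.ball xbar δ, ∀ x' ∈ Metric.ball xbar δ,
      |(φ x).toReal - (φ x').toReal| ≤ L * ‖x - x'‖

/-- Positive-linear dependence of a pair of families of vectors: a nontrivial vanishing linear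
combination, with nonnegative coefficients on the first family. -/
def PosLinDep {m : ℕ} {ι κ : Type} [Fintype ι] [Fintype κ] (a : ι → E m) (b : κ → E m) : Prop :=
  ∃ (α : ι → ℝ) (β : κ → ℝ), (∀ i, 0 ≤ α i) ∧ ((∃ i, α i ≠ 0) ∨ (∃ j, β j ≠ 0)) ∧
    ∑ i, α i • a i + ∑ j, β j • b j = 0

section Constraints

variable {n m p : ℕ} (ℓ : ℕ) (h : Fin p → E n → E m → ℝ)

/-- The feasible set mapping `Γ`. -/
def feas (x : E n) : Set (E m) :=
  {y | (∀ i ∈ ineqIdx p ℓ, h i x y ≤ 0) ∧ (∀ i ∈ eqIdx p ℓ, h i x y = 0)}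

/-- Indices of the active inequality constraints at `(x, y)`. -/
noncomputable def activeIdx (x : E n) (y : E m) : Finset (Fin p) :=
  open Classical in (ineqIdx p ℓ).filter fun i => h i x y = 0

/-- The family of partial gradients `∇_y h_i(x, y)`, `i ∈ K`. -/
noncomputable def gradFamily (K : Finset (Fin p)) (x : E n) (y : E m) : K → E m :=
  fun i => gradient (h i x) y

/-- The span of the family of partial gradients `∇_y h_i(x, y)`, `i ∈ K`. -/
noncomputable def gradSpan (K : Finset (Fin p)) (x : E n) (y : E m) : Submodule ℝ (E m) :=
  Submodule.span ℝ (Set.range (gradFamily h K x y))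

/-- The relaxed constant positive linear dependence constraint qualification for `Γ` at
`(xbar, ybar)`. -/
def RCPLD (xbar : E n) (ybar : E m) : Prop :=
  ∃ U ∈ 𝓝 (xbar, ybar), ∃ T : Finset (Fin p), T ⊆ eqIdx p ℓ ∧
    (LinearIndependent ℝ (gradFamily h T xbar ybar) ∧
      gradSpan h T xbar ybar = gradSpan h (eqIdx p ℓ) xbar ybar) ∧
    (∃ r : ℕ, ∀ z ∈ U, Module.finrank ℝ (gradSpan h (eqIdx p ℓ) z.1 z.2) = r) ∧
    (∀ K ⊆ activeIdx ℓ h xbar ybar,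
      PosLinDep (gradFamily h K xbar ybar) (gradFamily h T xbar ybar) →
        ∀ z ∈ U, ¬ LinearIndependent ℝ (gradFamily h (K ∪ T) z.1 z.2))

/-- For each parameter, the inequality constraints are convex and the equality constraints are
affine in the decision variable. -/
def ConvexAffine : Prop :=
  ∀ x : E n, (∀ i ∈ ineqIdx p ℓ, ConvexOn ℝ Set.univ (h i x)) ∧
    (∀ i ∈ eqIdx p ℓ, ∃ g : E m →ᵃ[ℝ] ℝ, ∀ y, h i x y = g y)

variable (f : E n → E m → ℝ)

/-- The marginal function `φ(x) = inf {f(x, y) | y ∈ Γ(x)}`, with `inf ∅ = ∞`. -/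
noncomputable def marginal (x : E n) : EReal := ⨅ y ∈ feas ℓ h x, (f x y : EReal)

/-- The solution mapping: the set of minimizers of `f(x, ·)` over `Γ(x)`. -/
def solMap (x : E n) : Set (E m) :=
  {y | y ∈ feas ℓ h x ∧ ∀ y' ∈ feas ℓ h x, f x y ≤ f x y'}

end Constraints

end ParamOpt

namespace ParamOpt

/-! The bound compares values through projections. Let `y` minimize at the parameter `x`, and let
`w` be the projection of `y` onto `Γ(x')`. If `‖y - w‖ ≤ C ‖x - x'‖`, then `φ(x') ≤ f(x', w) ≤ φ(x)
+ L ‖x - x'‖`, because `f` is Lipschitz on bounded sets; exchanging `x` and `x'` gives the rest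
(`locallyLipschitzAt_marginal`).

The error bound (`HasBoundedMultipliers.norm_sub_le`) rests on writing the residual `y - w` as a
combination of constraint gradients at `w` with multipliers at most `M ‖y - w‖`. Pairing this
identity with `y - w`, linearizing `h_i(x', ·)` with relative error `η`, and using complementarity
at `w` and feasibility of `y` for `x` gives `d² ≤ pMd(κ + ηd)` with `d = ‖y - w‖` and `κ = O(‖x -
x'‖)`. In case (a) convexity gives `η = 0`. In case (b) inner semicontinuity keeps `y` and `w` near
`ybar`, where `η` is small.

The multipliers are limits of penalty multipliers. RCPLD keeps these bounded: Carathéodory reduction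
modulo the span of the equality gradients leaves a linearly independent family, which by RCPLD comes
from a positive-linearly independent one at the base point, and for such families coefficients are
uniformly bounded (`RCPLD.exists_bounded_coefficients`). -/

/-! ### Conic combinations and bounds on their coefficients. -/

/-- Carathéodory's theorem for convex cones: a conic combination of finitely many vectors is a
conic combination of linearly independent ones among them. -/
theorem exists_linearIndepOn_conic_combination {ι V : Type*} [AddCommGroup V]
    [Module ℝ V] (a : ι → V) (A : Finset ι) (μ : ι → ℝ) (hμ : ∀ i ∈ A, 0 ≤ μ i) :
    ∃ K ⊆ A, ∃ ν : ι → ℝ, (∀ i ∈ K, 0 ≤ ν i) ∧ ∑ i ∈ K, ν i • a i = ∑ i ∈ A, μ i • a i ∧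
      LinearIndepOn ℝ a (K : Set ι) := by
  classical
  induction hn : A.card generalizing A μ with
  | zero =>
    obtain rfl := Finset.card_eq_zero.mp hn
    exact ⟨∅, by simp, 0, by simp, by simp, by simp⟩
  | succ n ih =>
    by_cases hA : LinearIndepOn ℝ a (A : Set ι)
    · exact ⟨A, subset_rfl, μ, hμ, rfl, hA⟩
    obtain ⟨g, hg, j, hj, hgj⟩ : ∃ g : ι → ℝ, ∑ i ∈ A, g i • a i = 0 ∧ ∃ j ∈ A, 0 < g j := by
      rw [linearIndepOn_finset_iff] at hA
      push Not at hA
      obtain ⟨g, hg, j, hj, hne⟩ := hA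
      rcases lt_or_gt_of_ne hne with hlt | hgt
      · exact ⟨-g, by simp [hg], j, hj, by simpa using hlt⟩
      · exact ⟨g, hg, j, hj, hgt⟩
    -- The minimal ratio is the largest multiple of the relation `g` that can be subtracted with all
    -- coefficients staying nonnegative; it makes the `k`-th one vanish.
    obtain ⟨k, hk, hmin⟩ := Finset.exists_min_image (A.filter fun i => 0 < g i)
      (fun i => μ i / g i) ⟨j, by simp [hj, hgj]⟩
    obtain ⟨hkA, hgk⟩ := Finset.mem_filter.mp hk
    set t := μ k / g k with ht
    have ht0 : 0 ≤ t := div_nonneg (hμ k hkA) hgk.le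
    have hzero : μ k - t * g k = 0 := by rw [ht]; field_simp; ring
    obtain ⟨K, hK, ν, hν, hsum, hind⟩ := ih (A.erase k) (fun i => μ i - t * g i) (by
        intro i hi
        have hiA := Finset.mem_of_mem_erase hi
        rcases lt_or_ge 0 (g i) with hpos | hneg
        · have := hmin i (Finset.mem_filter.mpr ⟨hiA, hpos⟩)
          rw [le_div_iff₀ hpos] at this
          linarith
        · have := hμ i hiA
          nlinarith [mul_nonneg ht0 (neg_nonneg.mpr hneg)])
      (by rw [Finset.card_erase_of_mem hkA, hn]; rfl)
    refine ⟨K, hK.trans (Finset.erase_subset _ _), ν, hν, ?_, hind⟩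
    rw [hsum, Finset.sum_erase _ (by simp only [hzero, zero_smul])]
    simp only [sub_smul, mul_smul, Finset.sum_sub_distrib, ← Finset.smul_sum, hg, smul_zero,
      sub_zero]

/-- If a closed cone of coefficients contains no nontrivial vanishing combination of a family of
vectors, then coefficients in the cone are controlled by the combination, uniformly under small
perturbations of the family. -/
theorem exists_eventually_norm_le_of_cone {ι Z V : Type*} [Fintype ι] [TopologicalSpace Z]
    [NormedAddCommGroup V] [NormedSpace ℝ V] (G : ι → Z → V) (z₀ : Z)
    (hG : ∀ i, ContinuousAt (G i) z₀) (C : Set (ι → ℝ)) (hC : IsClosed C)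
    (hcone : ∀ c ∈ C, ∀ t : ℝ, 0 ≤ t → t • c ∈ C)
    (hind : ∀ c ∈ C, ∑ i, c i • G i z₀ = 0 → c = 0) :
    ∃ M : ℝ, 0 < M ∧ ∀ᶠ z in 𝓝 z₀, ∀ c ∈ C, ‖c‖ ≤ M * ‖∑ i, c i • G i z‖ := by
  set S := C ∩ Metric.sphere (0 : ι → ℝ) 1 with hS
  have hScomp : IsCompact S := (isCompact_sphere _ _).inter_left hC
  obtain ⟨ε, hε, hεS⟩ : ∃ ε : ℝ, 0 < ε ∧ ∀ c ∈ S, ε < ‖∑ i, c i • G i z₀‖ := by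
    rcases S.eq_empty_or_nonempty with he | hne
    · exact ⟨1, one_pos, by simp [he]⟩
    obtain ⟨c, hc, hmin⟩ := hScomp.exists_isMinOn hne
      (f := fun c : ι → ℝ => ‖∑ i, c i • G i z₀‖) (by fun_prop)
    have hpos : 0 < ‖∑ i, c i • G i z₀‖ := by
      refine norm_pos_iff.mpr fun h0 => ?_
      have hc1 := hc.2
      rw [hind c hc.1 h0] at hc1
      simp at hc1
    exact ⟨_, half_pos hpos, fun c' hc' => (half_lt_self hpos).trans_le (hmin hc')⟩
  refine ⟨ε⁻¹, inv_pos.mpr hε, ?_⟩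
  have hev : ∀ᶠ z in 𝓝 z₀, ∀ c ∈ S, ε < ‖∑ i, c i • G i z‖ := by
    refine hScomp.eventually_forall_of_forall_eventually fun c hc => ?_
    have hcont : ContinuousAt (fun q : Z × (ι → ℝ) => ‖∑ i, q.2 i • G i q.1‖) (z₀, c) := by
      refine ContinuousAt.norm (tendsto_finsetSum _ fun i _ => ?_)
      refine Tendsto.smul (f := fun q : Z × (ι → ℝ) => q.2 i) (g := fun q => G i q.1) ?_ ?_
      · exact (Continuous.continuousAt (by fun_prop))
      · exact (hG i).tendsto.comp continuousAt_fst.tendsto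
    exact hcont.eventually_const_lt (hεS c hc)
  filter_upwards [hev] with z hz c hc
  rcases eq_or_ne c 0 with rfl | hne
  · simp
  have hn : 0 < ‖c‖ := norm_pos_iff.mpr hne
  have h1 := hz (‖c‖⁻¹ • c) ⟨hcone c hc _ (inv_nonneg.mpr hn.le), by
    simp [norm_smul, inv_mul_cancel₀ hn.ne']⟩
  have h2 : ∑ i, (‖c‖⁻¹ • c) i • G i z = ‖c‖⁻¹ • ∑ i, c i • G i z := by
    simp [Finset.smul_sum, mul_smul]
  rw [h2, norm_smul, norm_inv, norm_norm, inv_mul_eq_div, lt_div_iff₀ hn] at h1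
  rw [inv_mul_eq_div, le_div_iff₀ hε]
  linarith

/-! ### Quadratic penalization. -/

/-- Squaring removes the kink at zero, so the inequality penalty is differentiable and Fermat's rule
applies to it. -/
theorem hasDerivAt_max_zero_sq (t : ℝ) :
    HasDerivAt (fun s : ℝ => (max s 0) ^ 2) (2 * max t 0) t := by
  rcases lt_trichotomy t 0 with ht | rfl | ht
  · rw [max_eq_right ht.le, mul_zero]
    refine (hasDerivAt_const t (0 : ℝ)).congr_of_eventuallyEq ?_
    filter_upwards [gt_mem_nhds ht] with s hs
    simp [max_eq_right hs.le]
  · rw [hasDerivAt_iff_isLittleO_nhds_zero]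
    simp only [max_self, mul_zero, smul_zero, sub_zero, zero_add, ne_eq, OfNat.ofNat_ne_zero,
      not_false_eq_true, zero_pow]
    have h1 : (fun s : ℝ => (max s 0) ^ 2) =O[𝓝 0] fun s => s ^ 2 := by
      refine Asymptotics.IsBigO.of_bound 1 (Eventually.of_forall fun s => ?_)
      rw [Real.norm_eq_abs, Real.norm_eq_abs, abs_of_nonneg (sq_nonneg _),
        abs_of_nonneg (sq_nonneg _), one_mul]
      rcases le_total s 0 with hs | hs
      · simp [max_eq_right hs, sq_nonneg]
      · simp [max_eq_left hs]
    exact h1.trans_isLittleO (by simpa using Asymptotics.isLittleO_pow_id (𝕜 := ℝ) one_lt_two)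
  · rw [max_eq_left ht.le]
    have : HasDerivAt (fun s : ℝ => s ^ 2) (2 * t) t := by simpa using hasDerivAt_pow 2 t
    refine this.congr_of_eventuallyEq ?_
    filter_upwards [lt_mem_nhds ht] with s hs
    simp [max_eq_left hs.le]

/-- Approximate multipliers near the projection `w` of `u` onto a set given by smooth inequality
and equality constraints, by quadratic penalization. -/
theorem exists_approx_multipliers {V ι : Type*} [NormedAddCommGroup V] [InnerProductSpace ℝ V]
    [FiniteDimensional ℝ V] (I J : Finset ι) (g : ι → V → ℝ)
    (hg : ∀ i, Differentiable ℝ (g i)) (u w : V) (hwI : ∀ i ∈ I, g i w ≤ 0)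
    (hwJ : ∀ i ∈ J, g i w = 0)
    (hmin : ∀ y, (∀ i ∈ I, g i y ≤ 0) → (∀ i ∈ J, g i y = 0) → ‖w - u‖ ≤ ‖y - u‖)
    {ε : ℝ} (hε : 0 < ε) :
    ∃ (y : V) (α β : ι → ℝ), ‖y - w‖ < ε ∧ (∀ i, 0 ≤ α i) ∧ (∀ i, α i ≠ 0 → 0 < g i y) ∧
      ∑ i ∈ I, α i • gradient (g i) y + ∑ i ∈ J, β i • gradient (g i) y
        = (u - y) + (w - y) := by
  set P : V → ℝ := fun y => ∑ i ∈ I, (max (g i y) 0) ^ 2 + ∑ i ∈ J, (g i y) ^ 2 with hP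
  -- The term `‖y - w‖ ^ 2` makes `w` the strict minimizer among feasible points, even when the
  -- projection is not unique.
  set F : ℕ → V → ℝ := fun k y => ‖y - u‖ ^ 2 + ‖y - w‖ ^ 2 + k * P y with hF
  have hgc : ∀ i, Continuous (g i) := fun i => (hg i).continuous
  have hPc : Continuous P := by
    simp only [hP]
    fun_prop
  have hFc : ∀ k, Continuous (F k) := fun k => by
    simp only [hF]
    fun_prop
  have hP0 : ∀ y, 0 ≤ P y := fun y =>
    add_nonneg (Finset.sum_nonneg fun i _ => sq_nonneg _) (Finset.sum_nonneg fun i _ => sq_nonneg _)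
  have hPw : P w = 0 := by
    simp only [hP]
    rw [Finset.sum_eq_zero fun i hi => by rw [max_eq_right (hwI i hi)]; norm_num,
      Finset.sum_eq_zero fun i hi => by rw [hwJ i hi]; norm_num, add_zero]
  have hFw : ∀ k, F k w = ‖w - u‖ ^ 2 := fun k => by simp [hF, hPw]
  have hmono : ∀ y, Monotone fun k => F k y := fun y k l hkl => by
    have : (k : ℝ) ≤ l := by exact_mod_cast hkl
    simp only [hF]
    gcongr
  -- The open sets increase with `k` and cover the compact sphere, so a single `k` beats the value
  -- at `w` on all of it; a minimizer over the ball is then interior.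
  obtain ⟨k, hk⟩ : ∃ k, Metric.sphere w ε ⊆ {y | ‖w - u‖ ^ 2 < F k y} := by
    refine (isCompact_sphere w ε).elim_directed_cover _
      (fun k => isOpen_lt continuous_const (hFc k)) ?_ ?_
    · intro y hy
      rw [Set.mem_iUnion]
      rcases (hP0 y).eq_or_lt with h0 | hpos
      · have hI : ∀ i ∈ I, g i y ≤ 0 := by
          have h1 := (add_eq_zero_iff_of_nonneg
            (Finset.sum_nonneg fun i _ => sq_nonneg (max (g i y) 0))
            (Finset.sum_nonneg fun i _ => sq_nonneg (g i y))).mp h0.symm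
          intro i hi
          have := (Finset.sum_eq_zero_iff_of_nonneg fun i _ => sq_nonneg _).mp h1.1 i hi
          exact max_eq_right_iff.mp (pow_eq_zero_iff two_ne_zero |>.mp this)
        have hJ : ∀ i ∈ J, g i y = 0 := by
          have h1 := (add_eq_zero_iff_of_nonneg
            (Finset.sum_nonneg fun i _ => sq_nonneg (max (g i y) 0))
            (Finset.sum_nonneg fun i _ => sq_nonneg (g i y))).mp h0.symm
          intro i hi
          have := (Finset.sum_eq_zero_iff_of_nonneg fun i _ => sq_nonneg _).mp h1.2 i hi
          exact pow_eq_zero_iff two_ne_zero |>.mp this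
        refine ⟨0, ?_⟩
        have h2 := hmin y hI hJ
        have h3 : ‖y - w‖ = ε := by simpa [dist_eq_norm] using hy
        simp only [Set.mem_ofPred_eq, hF, h3, Nat.cast_zero, zero_mul, add_zero]
        have : ‖w - u‖ ^ 2 ≤ ‖y - u‖ ^ 2 := by gcongr
        have := pow_pos hε 2
        linarith
      · obtain ⟨k, hk⟩ := exists_nat_gt (‖w - u‖ ^ 2 / P y)
        rw [div_lt_iff₀ hpos] at hk
        refine ⟨k, ?_⟩
        simp only [Set.mem_ofPred_eq, hF]
        nlinarith [sq_nonneg ‖y - u‖, sq_nonneg ‖y - w‖]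
    · exact directed_of_isDirected_le fun k l hkl y hy => lt_of_lt_of_le hy (hmono y hkl)
  obtain ⟨y, hy, hymin⟩ := (isCompact_closedBall w ε).exists_isMinOn
    ⟨w, Metric.mem_closedBall_self hε.le⟩ (hFc k).continuousOn
  have hyε : dist y w < ε := by
    refine lt_of_le_of_ne hy fun heq => ?_
    have h1 := hk heq
    have h2 := hymin (Metric.mem_closedBall_self hε.le)
    simp only [Set.mem_ofPred_eq, hFw] at h1 h2
    linarith
  have hloc : IsLocalMin (F k) y :=
    hymin.isLocalMin (Filter.mem_of_superset (Metric.isOpen_ball.mem_nhds hyε)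
      Metric.ball_subset_closedBall)
  have hd : HasFDerivAt (F k)
      ((2 • innerSL ℝ (y - u) + 2 • innerSL ℝ (y - w)) +
        (k : ℝ) • (∑ i ∈ I, (2 * max (g i y) 0) • fderiv ℝ (g i) y +
          ∑ i ∈ J, (2 * g i y) • fderiv ℝ (g i) y)) y := by
    have hsq : ∀ v : V, HasFDerivAt (fun y => ‖y - v‖ ^ 2) (2 • innerSL ℝ (y - v)) y := fun v => by
      simpa using ((hasFDerivAt_id y).sub_const v).norm_sq
    refine ((hsq u).add (hsq w)).add (HasFDerivAt.const_mul (HasFDerivAt.add ?_ ?_) _)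
    · refine HasFDerivAt.fun_sum fun i _ => ?_
      exact (hasDerivAt_max_zero_sq (g i y)).comp_hasFDerivAt y (hg i y).hasFDerivAt
    · refine HasFDerivAt.fun_sum fun i _ => ?_
      simpa using ((hg i y).hasFDerivAt).pow 2
  have h0 := hloc.hasFDerivAt_eq_zero hd
  -- The multipliers are half the penalty derivatives, the factor 2 cancelling against the squared
  -- norms; on inequalities they are nonzero only where the constraint is violated.
  refine ⟨y, fun i => k * max (g i y) 0, fun i => k * g i y, by rwa [← dist_eq_norm],
    fun i => by positivity, fun i hi => ?_, ?_⟩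
  · by_contra hle
    exact hi (by simp only [max_eq_right (not_lt.mp hle), mul_zero])
  · refine ext_inner_right ℝ fun v => ?_
    have hv := congrArg (fun A : V →L[ℝ] ℝ => A v) h0
    have hgrad : ∀ i, inner ℝ (gradient (g i) y) v = fderiv ℝ (g i) y v := fun i => by
      simp [gradient]
    simp only [add_apply, smul_apply, sum_apply, innerSL_apply_apply,
      zero_apply, smul_eq_mul, nsmul_eq_mul, inner_sub_left, mul_assoc,
      ← Finset.mul_sum] at hv
    simp only [inner_add_left, sum_inner, inner_smul_left, hgrad, inner_sub_left, mul_assoc,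
      RCLike.conj_to_real, ← Finset.mul_sum]
    push_cast at hv
    linarith

/-! ### Partial gradients and the feasible set. -/

variable {n m p ℓ : ℕ} {h : Fin p → E n → E m → ℝ}

theorem hasFDerivAt_partial {g : E n → E m → ℝ}
    (hg : ContDiff ℝ 1 fun z : E n × E m => g z.1 z.2) (x : E n) (y : E m) :
    HasFDerivAt (g x) ((fderiv ℝ (fun z : E n × E m => g z.1 z.2) (x, y)).comp
      (ContinuousLinearMap.inr ℝ (E n) (E m))) y :=
  HasFDerivAt.comp y (g := fun z : E n × E m => g z.1 z.2)
    ((hg.differentiable one_ne_zero) (x, y)).hasFDerivAt (hasFDerivAt_prodMk_right x y)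

theorem differentiable_partial {g : E n → E m → ℝ}
    (hg : ContDiff ℝ 1 fun z : E n × E m => g z.1 z.2) (x : E n) : Differentiable ℝ (g x) :=
  fun y => (hasFDerivAt_partial hg x y).differentiableAt

theorem continuous_partial_gradient {g : E n → E m → ℝ}
    (hg : ContDiff ℝ 1 fun z : E n × E m => g z.1 z.2) :
    Continuous fun z : E n × E m => gradient (g z.1) z.2 := by
  have h1 : (fun z : E n × E m => gradient (g z.1) z.2) = fun z =>
      (InnerProductSpace.toDual ℝ (E m)).symm
        ((fderiv ℝ (fun z : E n × E m => g z.1 z.2) z).comp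
          (ContinuousLinearMap.inr ℝ (E n) (E m))) := by
    funext z
    rw [gradient, (hasFDerivAt_partial hg z.1 z.2).fderiv]
  rw [h1]
  refine (InnerProductSpace.toDual ℝ (E m)).symm.continuous.comp ?_
  exact (hg.continuous_fderiv one_ne_zero).clm_comp continuous_const

theorem isClosed_graph_feas (hh : ∀ i, ContDiff ℝ 1 fun z : E n × E m => h i z.1 z.2) :
    IsClosed {z : E n × E m | z.2 ∈ feas ℓ h z.1} := by
  have hset : {z : E n × E m | z.2 ∈ feas ℓ h z.1} =
      (⋂ i ∈ ineqIdx p ℓ, {z | h i z.1 z.2 ≤ 0}) ∩ ⋂ i ∈ eqIdx p ℓ, {z | h i z.1 z.2 = 0} := by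
    ext z
    simp [feas]
  rw [hset]
  exact (isClosed_biInter fun i _ => isClosed_le (hh i).continuous continuous_const).inter
    (isClosed_biInter fun i _ => isClosed_eq (hh i).continuous continuous_const)

theorem isClosed_feas (hh : ∀ i, ContDiff ℝ 1 fun z : E n × E m => h i z.1 z.2) (x : E n) :
    IsClosed (feas ℓ h x) :=
  (isClosed_graph_feas hh).preimage (Continuous.prodMk_right x)

theorem disjoint_ineqIdx_eqIdx : Disjoint (ineqIdx p ℓ) (eqIdx p ℓ) := by
  rw [Finset.disjoint_left]
  intro i hi hj
  simp only [ineqIdx, eqIdx, Finset.mem_filter] at hi hj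
  omega

theorem mem_ineqIdx_or_mem_eqIdx (i : Fin p) : i ∈ ineqIdx p ℓ ∨ i ∈ eqIdx p ℓ := by
  simp only [ineqIdx, eqIdx, Finset.mem_filter, Finset.mem_univ, true_and]
  omega

theorem activeIdx_subset (x : E n) (y : E m) : activeIdx ℓ h x y ⊆ ineqIdx p ℓ :=
  Finset.filter_subset _ _

theorem gradSpan_eq_span_image (K : Finset (Fin p)) (x : E n) (y : E m) :
    gradSpan h K x y = Submodule.span ℝ ((fun i => gradient (h i x) y) '' (K : Set (Fin p))) := by
  rw [gradSpan, Set.image_eq_range]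
  rfl

/-! ### Bounded multipliers under RCPLD. -/

/-- Coefficients that are nonnegative on `K` and vanish outside `K ∪ T` are bounded by the
corresponding combination of gradients if the gradients are positive-linearly independent. -/
theorem exists_bound_of_not_posLinDep
    (hh : ∀ i, ContDiff ℝ 1 fun z : E n × E m => h i z.1 z.2) (xbar : E n) (ybar : E m)
    {K T : Finset (Fin p)} (hKT : Disjoint K T)
    (hind : ¬ PosLinDep (gradFamily h K xbar ybar) (gradFamily h T xbar ybar)) :
    ∃ M : ℝ, 0 < M ∧ ∀ᶠ z : E n × E m in 𝓝 (xbar, ybar), ∀ c : Fin p → ℝ, (∀ i ∈ K, 0 ≤ c i) →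
      (∀ i, i ∉ K → i ∉ T → c i = 0) →
      ‖c‖ ≤ M * ‖∑ i, c i • gradient (h i z.1) z.2‖ := by
  set C : Set (Fin p → ℝ) := {c | (∀ i ∈ K, 0 ≤ c i) ∧ ∀ i, i ∉ K → i ∉ T → c i = 0} with hC
  have hclosed : IsClosed C := by
    have hset : C = (⋂ i ∈ K, {c | 0 ≤ c i}) ∩
        ⋂ i, ⋂ (_ : i ∉ K), ⋂ (_ : i ∉ T), {c | c i = 0} := by
      ext c
      simp [hC]
    rw [hset]
    exact (isClosed_biInter fun i _ => isClosed_le continuous_const (continuous_apply i)).inter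
      (isClosed_iInter fun i => isClosed_iInter fun _ => isClosed_iInter fun _ =>
        isClosed_eq (continuous_apply i) continuous_const)
  have hcone : ∀ c ∈ C, ∀ t : ℝ, 0 ≤ t → t • c ∈ C := by
    rintro c ⟨h1, h2⟩ t ht
    exact ⟨fun i hi => mul_nonneg ht (h1 i hi), fun i hi hi' => by simp [h2 i hi hi']⟩
  have hzero : ∀ c ∈ C, ∑ i, c i • gradient (h i xbar) ybar = 0 → c = 0 := by
    rintro c ⟨h1, h2⟩ hsum
    by_contra hne
    obtain ⟨j, hj⟩ := Function.ne_iff.mp hne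
    refine hind ⟨fun i => c i, fun i => c i, fun i => h1 i i.2, ?_, ?_⟩
    · by_cases hjK : j ∈ K
      · exact Or.inl ⟨⟨j, hjK⟩, hj⟩
      · by_cases hjT : j ∈ T
        · exact Or.inr ⟨⟨j, hjT⟩, hj⟩
        · exact absurd (h2 j hjK hjT) hj
    · have e1 := Finset.sum_coe_sort K fun i => c i • gradient (h i xbar) ybar
      have e2 := Finset.sum_coe_sort T fun i => c i • gradient (h i xbar) ybar
      simp only [gradFamily]
      rw [e1, e2, ← Finset.sum_union hKT, ← hsum]
      refine Finset.sum_subset (Finset.subset_univ _) fun i _ hi => ?_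
      rw [Finset.mem_union, not_or] at hi
      rw [h2 i hi.1 hi.2, zero_smul]
  obtain ⟨M, hM, hev⟩ := exists_eventually_norm_le_of_cone
    (fun i (z : E n × E m) => gradient (h i z.1) z.2) (xbar, ybar)
    (fun i => (continuous_partial_gradient (hh i)).continuousAt) C hclosed hcone hzero
  exact ⟨M, hM, hev.mono fun z hz c h1 h2 => hz c ⟨h1, h2⟩⟩

/-- Under RCPLD every combination of the gradients with coefficients of the right signs can be
rewritten with coefficients that are bounded by the norm of the combination. -/
theorem RCPLD.exists_bounded_coefficients
    (hh : ∀ i, ContDiff ℝ 1 fun z : E n × E m => h i z.1 z.2) {xbar : E n} {ybar : E m}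
    (hy : ybar ∈ feas ℓ h xbar) (hR : RCPLD ℓ h xbar ybar) :
    ∃ M : ℝ, 0 < M ∧ ∀ᶠ z : E n × E m in 𝓝 (xbar, ybar), ∀ α β : Fin p → ℝ, (∀ i, 0 ≤ α i) →
      (∀ i, α i ≠ 0 → 0 < h i z.1 z.2) →
      ∃ c : Fin p → ℝ, (∀ i ∈ ineqIdx p ℓ, 0 ≤ c i) ∧ (∀ i ∈ ineqIdx p ℓ, c i ≠ 0 → α i ≠ 0) ∧
        ∑ i, c i • gradient (h i z.1) z.2 =
          ∑ i ∈ ineqIdx p ℓ, α i • gradient (h i z.1) z.2 +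
            ∑ i ∈ eqIdx p ℓ, β i • gradient (h i z.1) z.2 ∧
        ∀ i, |c i| ≤ M * ‖∑ i, c i • gradient (h i z.1) z.2‖ := by
  classical
  obtain ⟨U, hU, T, hT, ⟨hTind, hTspan⟩, ⟨r, hr⟩, hdep⟩ := hR
  have hbound : ∀ K : Finset (Fin p), ∃ M : ℝ, 0 < M ∧
      (K ⊆ activeIdx ℓ h xbar ybar →
        ¬ PosLinDep (gradFamily h K xbar ybar) (gradFamily h T xbar ybar) →
        ∀ᶠ z : E n × E m in 𝓝 (xbar, ybar), ∀ c : Fin p → ℝ, (∀ i ∈ K, 0 ≤ c i) →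
        (∀ i, i ∉ K → i ∉ T → c i = 0) →
        ‖c‖ ≤ M * ‖∑ i, c i • gradient (h i z.1) z.2‖) := by
    intro K
    by_cases hK : K ⊆ activeIdx ℓ h xbar ybar ∧
        ¬ PosLinDep (gradFamily h K xbar ybar) (gradFamily h T xbar ybar)
    · obtain ⟨M, hM, hev⟩ := exists_bound_of_not_posLinDep hh xbar ybar
        (disjoint_ineqIdx_eqIdx.mono (hK.1.trans (activeIdx_subset _ _)) hT) hK.2
      exact ⟨M, hM, fun _ _ => hev⟩
    · exact ⟨1, one_pos, fun h1 h2 => absurd ⟨h1, h2⟩ hK⟩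
  choose M hM hMev using hbound
  -- There are finitely many index sets, so the sum dominates every constant; sets not meeting the
  -- conditions carry the dummy value 1.
  refine ⟨∑ K, M K, Finset.sum_pos (fun K _ => hM K) Finset.univ_nonempty, ?_⟩
  have hev : ∀ᶠ z : E n × E m in 𝓝 (xbar, ybar), ∀ K : Finset (Fin p),
      K ⊆ activeIdx ℓ h xbar ybar →
        ¬ PosLinDep (gradFamily h K xbar ybar) (gradFamily h T xbar ybar) →
        ∀ c : Fin p → ℝ, (∀ i ∈ K, 0 ≤ c i) → (∀ i, i ∉ K → i ∉ T → c i = 0) →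
        ‖c‖ ≤ M K * ‖∑ i, c i • gradient (h i z.1) z.2‖ := by
    refine eventually_all.mpr fun K => ?_
    by_cases hK : K ⊆ activeIdx ℓ h xbar ybar ∧
        ¬ PosLinDep (gradFamily h K xbar ybar) (gradFamily h T xbar ybar)
    · exact (hMev K hK.1 hK.2).mono fun z hz _ _ => hz
    · exact Eventually.of_forall fun z h1 h2 => absurd ⟨h1, h2⟩ hK
  have hevT : ∀ᶠ z : E n × E m in 𝓝 (xbar, ybar),
      LinearIndependent ℝ (gradFamily h T z.1 z.2) := by
    have hc : Continuous fun z : E n × E m => gradFamily h T z.1 z.2 :=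
      continuous_pi fun i => continuous_partial_gradient (hh i)
    exact (hc.tendsto (xbar, ybar)).eventually hTind.eventually
  have hevI : ∀ᶠ z : E n × E m in 𝓝 (xbar, ybar), ∀ i, i ∈ ineqIdx p ℓ → 0 < h i z.1 z.2 →
      i ∈ activeIdx ℓ h xbar ybar := by
    refine eventually_all.mpr fun i => ?_
    by_cases hi : i ∈ ineqIdx p ℓ
    · rcases (hy.1 i hi).eq_or_lt with h0 | hneg
      · exact Eventually.of_forall fun z _ _ => Finset.mem_filter.mpr ⟨hi, h0⟩
      · filter_upwards [(hh i).continuous.continuousAt.eventually_lt_const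
          (show h i (xbar, ybar).1 (xbar, ybar).2 < 0 from hneg)] with z hz _ hpos
        exact absurd hpos hz.not_gt
    · exact Eventually.of_forall fun z h1 => absurd h1 hi
  filter_upwards [hU, hev, hevT, hevI] with z hzU hz hzT hzI α β hα hαpos
  set G : Fin p → E m := fun i => gradient (h i z.1) z.2 with hG
  set W := Submodule.span ℝ (G '' (T : Set (Fin p))) with hW
  -- The gradients over `T` stay independent near the base point and the equality rank is constant,
  -- so they still span all equality gradients.
  have hWeq : gradSpan h (eqIdx p ℓ) z.1 z.2 = W := by
    have hle : W ≤ gradSpan h (eqIdx p ℓ) z.1 z.2 := by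
      rw [gradSpan_eq_span_image]
      exact Submodule.span_mono (Set.image_mono (by exact_mod_cast hT))
    refine (Submodule.eq_of_le_of_finrank_eq hle ?_).symm
    rw [hr z hzU, ← hr _ (mem_of_mem_nhds hU), ← hTspan, hW, ← gradSpan_eq_span_image,
      gradSpan, gradSpan, finrank_span_eq_card hzT, finrank_span_eq_card hTind]
  -- Reducing modulo `W` leaves the equality part free: independence in the quotient makes `K ∪ T`
  -- independent, and the discrepancy lies in `W`.
  obtain ⟨K, hKA, ν, hν, hνsum, hKind⟩ := exists_linearIndepOn_conic_combination
    (fun i => W.mkQ (G i)) ((ineqIdx p ℓ).filter fun i => α i ≠ 0) α fun i _ => hα i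
  have hKI : K ⊆ ineqIdx p ℓ := hKA.trans (Finset.filter_subset _ _)
  have hKα : ∀ i ∈ K, α i ≠ 0 := fun i hi => (Finset.mem_filter.mp (hKA hi)).2
  have hKact : K ⊆ activeIdx ℓ h xbar ybar := fun i hi => hzI i (hKI hi) (hαpos i (hKα i hi))
  have hKT : Disjoint K T := disjoint_ineqIdx_eqIdx.mono hKI hT
  have hli : LinearIndependent ℝ (gradFamily h (K ∪ T) z.1 z.2) := by
    have h1 : LinearIndepOn ℝ G (T : Set (Fin p)) := hzT
    have h2 : LinearIndepOn ℝ G ((T : Set (Fin p)) ∪ K) := h1.union_of_quotient hKind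
    rw [Set.union_comm, ← Finset.coe_union] at h2
    exact h2
  have hnpd : ¬ PosLinDep (gradFamily h K xbar ybar) (gradFamily h T xbar ybar) :=
    fun hpd => hdep K hKact hpd z hzU hli
  have hmem : ∑ i ∈ ineqIdx p ℓ, α i • G i + ∑ i ∈ eqIdx p ℓ, β i • G i - ∑ i ∈ K, ν i • G i
      ∈ W := by
    have h1 : ∑ i ∈ eqIdx p ℓ, β i • G i ∈ W := by
      rw [← hWeq, gradSpan_eq_span_image]
      exact Submodule.sum_mem _ fun i hi => Submodule.smul_mem _ _
        (Submodule.subset_span ⟨i, hi, rfl⟩)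
    have h2 : ∑ i ∈ ineqIdx p ℓ, α i • G i - ∑ i ∈ K, ν i • G i ∈ W := by
      rw [← W.ker_mkQ, LinearMap.mem_ker, map_sub, map_sum, map_sum, sub_eq_zero]
      simp only [map_smul]
      rw [hνsum, Finset.sum_filter_of_ne]
      intro i _ hne h0
      exact hne (by rw [h0, zero_smul])
    rw [add_sub_right_comm]
    exact W.add_mem h2 h1
  obtain ⟨γ, hγ⟩ := (Submodule.mem_span_image_finset_iff_exists_fun' ℝ).mp hmem
  set c : Fin p → ℝ := fun i => (if i ∈ K then ν i else 0) + if i ∈ T then γ i else 0 with hc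
  have hcK : ∀ i ∈ K, c i = ν i := fun i hi => by
    simp [hc, hi, Finset.disjoint_left.mp hKT hi]
  have hcI : ∀ i ∈ ineqIdx p ℓ, i ∉ K → c i = 0 := fun i hi hiK => by
    have : i ∉ T := fun hiT => Finset.disjoint_left.mp disjoint_ineqIdx_eqIdx hi (hT hiT)
    simp [hc, hiK, this]
  have hcsum : ∑ i, c i • G i = ∑ i ∈ ineqIdx p ℓ, α i • G i + ∑ i ∈ eqIdx p ℓ, β i • G i := by
    have : ∑ i, c i • G i = ∑ i ∈ K, ν i • G i + ∑ i ∈ T, γ i • G i := by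
      simp only [hc, add_smul, ite_smul, zero_smul, Finset.sum_add_distrib, Finset.sum_ite_mem,
        Finset.univ_inter]
    rw [this, hγ]
    abel
  refine ⟨c, fun i hi => ?_, fun i hi hne => ?_, hcsum, fun i => ?_⟩
  · by_cases hiK : i ∈ K
    · rw [hcK i hiK]
      exact hν i hiK
    · rw [hcI i hi hiK]
  · by_cases hiK : i ∈ K
    · exact hKα i hiK
    · exact absurd (hcI i hi hiK) hne
  · have h1 := hz K hKact hnpd c (fun i hi => by rw [hcK i hi]; exact hν i hi)
      (fun i hi hi' => by simp [hc, hi, hi'])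
    refine (norm_le_pi_norm c i).trans (h1.trans ?_)
    gcongr
    exact Finset.single_le_sum (fun K _ => (hM K).le) (Finset.mem_univ K)

/-- At a point `w` of `Γ(x)`, every projection residual `u - w` is given by Lagrange multipliers
of size at most `M ‖u - w‖`. -/
def HasBoundedMultipliers (ℓ : ℕ) (h : Fin p → E n → E m → ℝ) (M : ℝ) (x : E n) (w : E m) : Prop :=
  ∀ u : E m, w ∈ feas ℓ h x → (∀ y ∈ feas ℓ h x, ‖w - u‖ ≤ ‖y - u‖) →
    ∃ c : Fin p → ℝ, (∀ i ∈ ineqIdx p ℓ, 0 ≤ c i) ∧ (∀ i ∈ ineqIdx p ℓ, c i ≠ 0 → h i x w = 0) ∧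
      ∑ i, c i • gradient (h i x) w = u - w ∧ ∀ i, |c i| ≤ M * ‖u - w‖

/-- Approximate multipliers at penalty minimizers tending to `w` are rewritten with bounded
coefficients; a convergent subsequence yields exact multipliers with the same constant. -/
theorem RCPLD.exists_eventually_hasBoundedMultipliers
    (hh : ∀ i, ContDiff ℝ 1 fun z : E n × E m => h i z.1 z.2) {xbar : E n} {ybar : E m}
    (hy : ybar ∈ feas ℓ h xbar) (hR : RCPLD ℓ h xbar ybar) :
    ∃ M : ℝ, 0 < M ∧ ∀ᶠ z : E n × E m in 𝓝 (xbar, ybar),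
      HasBoundedMultipliers ℓ h M z.1 z.2 := by
  obtain ⟨M, hM, hev⟩ := hR.exists_bounded_coefficients hh hy
  refine ⟨M, hM, ?_⟩
  -- The coefficient bound is needed at points near `w`, not only at `w` itself.
  filter_upwards [eventually_eventually_nhds.mpr hev] with z hz u hw hmin
  obtain ⟨x, w⟩ := z
  dsimp only at hw hmin ⊢
  have hzx : ∀ᶠ y in 𝓝 w, _ := (Continuous.prodMk_right x).continuousAt.eventually hz
  obtain ⟨ρ, hρ, hball⟩ := Metric.eventually_nhds_iff.mp hzx
  have hstep : ∀ k : ℕ, ∃ (y : E m) (c : Fin p → ℝ), ‖y - w‖ < 1 / ((k : ℝ) + 1) ∧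
      (∀ i ∈ ineqIdx p ℓ, 0 ≤ c i) ∧ (∀ i ∈ ineqIdx p ℓ, c i ≠ 0 → 0 ≤ h i x y) ∧
      ∑ i, c i • gradient (h i x) y = (u - y) + (w - y) ∧
      ∀ i, |c i| ≤ M * ‖(u - y) + (w - y)‖ := by
    intro k
    obtain ⟨y, α, β, hyw, hα, hαpos, hsum⟩ := exists_approx_multipliers (ineqIdx p ℓ) (eqIdx p ℓ)
      (fun i => h i x) (fun i => differentiable_partial (hh i) x) u w hw.1 hw.2
      (fun y h1 h2 => hmin y ⟨h1, h2⟩) (lt_min hρ (Nat.one_div_pos_of_nat (n := k) (α := ℝ)))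
    obtain ⟨c, hc0, hcα, hcsum, hcb⟩ := hball
      (by rw [dist_eq_norm]; exact hyw.trans_le (min_le_left _ _)) α β hα hαpos
    dsimp only at hcsum hcb
    rw [hcsum, hsum] at hcb
    exact ⟨y, c, hyw.trans_le (min_le_right _ _), hc0,
      fun i hi hne => (hαpos i (hcα i hi hne)).le, hcsum.trans hsum, hcb⟩
  choose y c hyw hc0 hcomp hsum hcb using hstep
  have hy_lim : Tendsto y atTop (𝓝 w) := by
    rw [tendsto_iff_norm_sub_tendsto_zero]
    exact squeeze_zero (fun k => norm_nonneg _) (fun k => (hyw k).le)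
      tendsto_one_div_add_atTop_nhds_zero_nat
  have hv_lim : Tendsto (fun k => (u - y k) + (w - y k)) atTop (𝓝 (u - w)) := by
    simpa using (hy_lim.const_sub u).add (hy_lim.const_sub w)
  obtain ⟨R, hRb⟩ := hv_lim.norm.bddAbove_range
  have hcR : ∀ k, c k ∈ Metric.closedBall (0 : Fin p → ℝ) (M * R) := fun k => by
    have hvR : ‖(u - y k) + (w - y k)‖ ≤ R := hRb ⟨k, rfl⟩
    rw [mem_closedBall_zero_iff, pi_norm_le_iff_of_nonneg
      (mul_nonneg hM.le ((norm_nonneg _).trans hvR))]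
    exact fun i => (hcb k i).trans (by gcongr)
  obtain ⟨b, -, φ, hφ, hb⟩ := tendsto_subseq_of_bounded Metric.isBounded_closedBall hcR
  have hbi : ∀ i, Tendsto (fun k => c (φ k) i) atTop (𝓝 (b i)) := fun i =>
    (tendsto_pi_nhds.mp hb) i
  have hyφ := hy_lim.comp hφ.tendsto_atTop
  have hvφ := hv_lim.comp hφ.tendsto_atTop
  have hpair : Tendsto (fun k => (x, y (φ k))) atTop (𝓝 (x, w)) :=
    tendsto_const_nhds.prodMk_nhds hyφ
  refine ⟨b, fun i hi => ge_of_tendsto' (hbi i) fun k => hc0 _ i hi, fun i hi hne => ?_, ?_,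
    fun i => ?_⟩
  -- A nonzero limit multiplier is nonzero along the tail, where the constraint value is
  -- nonnegative; the limit meets feasibility from the other side.
  · refine le_antisymm (hw.1 i hi) ?_
    refine ge_of_tendsto (((hh i).continuous.tendsto (x, w)).comp hpair) ?_
    filter_upwards [(hbi i).eventually_ne hne] with k hk
    exact hcomp _ i hi hk
  · refine tendsto_nhds_unique (f := fun k => ∑ i, c (φ k) i • gradient (h i x) (y (φ k)))
      (l := atTop) ?_ ?_
    · exact tendsto_finsetSum _ fun i _ => (hbi i).smul
        (((continuous_partial_gradient (hh i)).tendsto (x, w)).comp hpair)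
    · exact hvφ.congr fun k => (hsum _).symm
  · exact le_of_tendsto_of_tendsto' (hbi i).abs (hvφ.norm.const_mul M) fun k => hcb _ i

/-! ### Error bound from bounded multipliers. -/

/-- Error bound: if the constraints are almost linearized from below at the projection `w` of
`y ∈ Γ(x)` onto `Γ(x')`, then `‖y - w‖` is controlled by the change of the constraints. -/
theorem HasBoundedMultipliers.norm_sub_le {M η κ : ℝ} {x x' : E n} {y w : E m} (hη : 0 ≤ η)
    (hM : 0 ≤ M) (hpη : p * M * η ≤ 1 / 2) (hmult : HasBoundedMultipliers ℓ h M x' w)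
    (hy : y ∈ feas ℓ h x) (hw : w ∈ feas ℓ h x')
    (hmin : ∀ z ∈ feas ℓ h x', ‖w - y‖ ≤ ‖z - y‖)
    (hlin : ∀ i, ∀ t : ℝ, (i ∈ ineqIdx p ℓ → 0 ≤ t) → t * inner ℝ (gradient (h i x') w) (y - w) ≤
      t * (h i x' y - h i x' w) + |t| * (η * ‖y - w‖))
    (hκ : ∀ i, |h i x' y - h i x y| ≤ κ) :
    ‖y - w‖ ≤ 2 * p * M * κ := by
  obtain ⟨c, hc0, hcomp, hsum, hcb⟩ := hmult y hw hmin
  set d := ‖y - w‖ with hd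
  have hd0 : 0 ≤ d := norm_nonneg _
  have hterm : ∀ i, c i * inner ℝ (gradient (h i x') w) (y - w) ≤ M * d * κ + M * d * (η * d) := by
    intro i
    have h1 := hlin i (c i) (hc0 i)
    have hκ0 : 0 ≤ κ := (abs_nonneg _).trans (hκ i)
    have h2 : c i * (h i x' y - h i x' w) ≤ |c i| * κ := by
      have h3 : c i * (h i x' y - h i x y) ≤ |c i| * κ :=
        (le_abs_self _).trans (by rw [abs_mul]; exact mul_le_mul_of_nonneg_left (hκ i) (abs_nonneg _))
      rcases mem_ineqIdx_or_mem_eqIdx (ℓ := ℓ) i with hi | hi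
      · have h4 : c i * h i x' w = 0 := by
          by_cases h0 : c i = 0
          · rw [h0, zero_mul]
          · rw [hcomp i hi h0, mul_zero]
        have h5 : c i * h i x y ≤ 0 := mul_nonpos_of_nonneg_of_nonpos (hc0 i hi) (hy.1 i hi)
        linarith
      · rw [hw.2 i hi]
        rw [hy.2 i hi] at h3
        exact h3
    calc _ ≤ |c i| * κ + |c i| * (η * d) := h1.trans (by gcongr)
      _ ≤ _ := by
        have := hcb i
        gcongr
  have hsq : d * d ≤ p * (M * d * κ + M * d * (η * d)) := by
    calc d * d = inner ℝ (∑ i, c i • gradient (h i x') w) (y - w) := by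
          rw [hsum, real_inner_self_eq_norm_mul_norm]
      _ = ∑ i, c i * inner ℝ (gradient (h i x') w) (y - w) := by
          simp [sum_inner, inner_smul_left]
      _ ≤ ∑ _i : Fin p, (M * d * κ + M * d * (η * d)) := Finset.sum_le_sum fun i _ => hterm i
      _ = _ := by simp [mul_add]
  have h6 : p * M * η * (d * d) ≤ 1 / 2 * (d * d) := by gcongr
  -- Since `p * M * η ≤ 1 / 2`, the linearization error is absorbed by the left side.
  have h7 : d * d ≤ 2 * p * M * κ * d := by nlinarith
  rcases hd0.eq_or_lt with h0 | hpos
  · rw [← h0]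
    -- Nonnegativity of `κ` is available only from some index; without constraints the factor `p`
    -- vanishes.
    rcases isEmpty_or_nonempty (Fin p) with he | ⟨⟨i⟩⟩
    · have : p = 0 := by
        by_contra hp
        exact he.elim ⟨0, Nat.pos_of_ne_zero hp⟩
      simp [this]
    · have := (abs_nonneg _).trans (hκ i)
      positivity
  · exact le_of_mul_le_mul_right h7 hpos

/-! ### Linearization estimates, Lipschitz constants and projections. -/

theorem inner_gradient_le_of_convexOn {V : Type*} [NormedAddCommGroup V] [InnerProductSpace ℝ V]
    [CompleteSpace V] {g : V → ℝ} (hg : ConvexOn ℝ Set.univ g) {w : V}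
    (hd : DifferentiableAt ℝ g w) (y : V) : inner ℝ (gradient g w) (y - w) ≤ g y - g w := by
  have h1 : ConvexOn ℝ Set.univ (g ∘ AffineMap.lineMap (k := ℝ) w y) := by
    simpa using hg.comp_affineMap (AffineMap.lineMap (k := ℝ) w y)
  have h2 : HasDerivAt (g ∘ AffineMap.lineMap (k := ℝ) w y) (fderiv ℝ g w (y - w)) 0 := by
    refine HasFDerivAt.comp_hasDerivAt (0 : ℝ) (by simpa using hd.hasFDerivAt) ?_
    exact AffineMap.hasDerivAt_lineMap
  have h3 := h1.le_slope_of_hasDerivAt (Set.mem_univ 0) (Set.mem_univ 1) one_pos h2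
  simpa [slope_def_field, gradient] using h3

/-- Convex inequality and affine equality constraints are linearized from below. -/
theorem ConvexAffine.mul_inner_gradient_le (hconv : ConvexAffine ℓ h)
    (hh : ∀ i, ContDiff ℝ 1 fun z : E n × E m => h i z.1 z.2) (x : E n) (y w : E m) (i : Fin p)
    (t : ℝ) (ht : i ∈ ineqIdx p ℓ → 0 ≤ t) :
    t * inner ℝ (gradient (h i x) w) (y - w) ≤ t * (h i x y - h i x w) := by
  have hd := differentiable_partial (hh i) x w
  rcases mem_ineqIdx_or_mem_eqIdx (ℓ := ℓ) i with hi | hi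
  · exact mul_le_mul_of_nonneg_left (inner_gradient_le_of_convexOn ((hconv x).1 i hi) hd y) (ht hi)
  · obtain ⟨g, hg⟩ := (hconv x).2 i hi
    have hfun : h i x = g := funext hg
    have hcvx : ConvexOn ℝ Set.univ (h i x) := by
      rw [hfun]
      exact (convexOn_id convex_univ).comp_affineMap g
    have hccv : ConvexOn ℝ Set.univ (-h i x) := by
      rw [hfun, neg_convexOn_iff]
      exact (concaveOn_id convex_univ).comp_affineMap g
    have h1 := inner_gradient_le_of_convexOn hcvx hd y
    have h2 := inner_gradient_le_of_convexOn hccv hd.neg y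
    have h3 : gradient (-h i x) w = -gradient (h i x) w := by
      simp only [gradient, fderiv_neg, map_neg]
    rw [h3, inner_neg_left, Pi.neg_apply, Pi.neg_apply] at h2
    have h4 : inner ℝ (gradient (h i x) w) (y - w) = h i x y - h i x w := by linarith
    rw [h4]

/-- Partial linearizations of a continuously differentiable function are uniformly accurate near a
point. -/
theorem eventually_abs_sub_inner_gradient_le {g : E n → E m → ℝ}
    (hg : ContDiff ℝ 1 fun z : E n × E m => g z.1 z.2) (xbar : E n) (ybar : E m) {η : ℝ}
    (hη : 0 < η) :
    ∀ᶠ q : E n × E m × E m in 𝓝 (xbar, ybar, ybar),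
      |g q.1 q.2.1 - g q.1 q.2.2 - inner ℝ (gradient (g q.1) q.2.2) (q.2.1 - q.2.2)| ≤
        η * ‖q.2.1 - q.2.2‖ := by
  set H : E n × E m → ℝ := fun z => g z.1 z.2 with hH
  -- Strict differentiability handles increments with the derivative frozen at the base point;
  -- continuity of the derivative then moves it to `(x, w)`. Each costs `η / 2`.
  have hstrict : HasStrictFDerivAt H (fderiv ℝ H (xbar, ybar)) (xbar, ybar) :=
    hg.contDiffAt.hasStrictFDerivAt one_ne_zero
  have h1 := (hasStrictFDerivAt_iff_isLittleO.mp hstrict).def (half_pos hη)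
  have hpair : Tendsto (fun q : E n × E m × E m => ((q.1, q.2.1), (q.1, q.2.2)))
      (𝓝 (xbar, ybar, ybar)) (𝓝 ((xbar, ybar), (xbar, ybar))) :=
    Continuous.tendsto' (by fun_prop) _ _ rfl
  have hcont : ∀ᶠ q : E n × E m × E m in 𝓝 (xbar, ybar, ybar),
      dist (fderiv ℝ H (q.1, q.2.2)) (fderiv ℝ H (xbar, ybar)) < η / 2 := by
    have hc : Continuous fun q : E n × E m × E m => fderiv ℝ H (q.1, q.2.2) :=
      (hg.continuous_fderiv one_ne_zero).comp (by fun_prop)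
    exact Metric.tendsto_nhds.mp (hc.tendsto (xbar, ybar, ybar)) _ (half_pos hη)
  filter_upwards [hpair.eventually h1, hcont] with ⟨x, y, w⟩ hq hq'
  dsimp only at hq hq' ⊢
  have hgrad : inner ℝ (gradient (g x) w) (y - w) = fderiv ℝ H (x, w) (0, y - w) := by
    rw [gradient, (hasFDerivAt_partial hg x w).fderiv, InnerProductSpace.toDual_symm_apply]
    rfl
  have hnorm : ‖((0 : E n), y - w)‖ = ‖y - w‖ := by simp [Prod.norm_def]
  have e1 : |g x y - g x w - fderiv ℝ H (xbar, ybar) (0, y - w)| ≤ η / 2 * ‖y - w‖ := by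
    rw [← hnorm]
    simpa [hH] using hq
  have e2 : |fderiv ℝ H (x, w) (0, y - w) - fderiv ℝ H (xbar, ybar) (0, y - w)| ≤
      η / 2 * ‖y - w‖ := by
    rw [← sub_apply, ← Real.norm_eq_abs, ← hnorm]
    refine (ContinuousLinearMap.le_opNorm _ _).trans ?_
    rw [dist_eq_norm] at hq'
    gcongr
  rw [hgrad]
  rw [abs_le] at e1 e2 ⊢
  constructor <;> linarith [e1.1, e1.2, e2.1, e2.2]

theorem exists_lipschitz_bound_on_closedBall {g : E n → E m → ℝ}
    (hg : ContDiff ℝ 1 fun z : E n × E m => g z.1 z.2) (z₀ : E n × E m) (R : ℝ) :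
    ∃ L : ℝ, 0 ≤ L ∧ ∀ x x' y y', (x, y) ∈ Metric.closedBall z₀ R →
      (x', y') ∈ Metric.closedBall z₀ R → |g x y - g x' y'| ≤ L * (‖x - x'‖ + ‖y - y'‖) := by
  obtain ⟨K, hK⟩ := hg.contDiffOn.exists_lipschitzOnWith one_ne_zero
    (convex_closedBall z₀ R) (isCompact_closedBall z₀ R)
  refine ⟨K, K.2, fun x x' y y' hz hz' => ?_⟩
  have h1 := hK.dist_le_mul _ hz _ hz'
  rw [Real.dist_eq] at h1
  refine h1.trans (mul_le_mul_of_nonneg_left ?_ K.2)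
  rw [Prod.dist_eq, dist_eq_norm, dist_eq_norm]
  exact max_le_add_of_nonneg (norm_nonneg _) (norm_nonneg _)

theorem exists_lipschitz_bound_family (hh : ∀ i, ContDiff ℝ 1 fun z : E n × E m => h i z.1 z.2)
    (z₀ : E n × E m) (R : ℝ) :
    ∃ L : ℝ, 0 ≤ L ∧ ∀ i x x' y, (x, y) ∈ Metric.closedBall z₀ R →
      (x', y) ∈ Metric.closedBall z₀ R → |h i x y - h i x' y| ≤ L * ‖x - x'‖ := by
  choose L hL0 hL using fun i => exists_lipschitz_bound_on_closedBall (hh i) z₀ R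
  refine ⟨∑ i, L i, Finset.sum_nonneg fun i _ => hL0 i, fun i x x' y hz hz' => ?_⟩
  have h1 := hL i x x' y y hz hz'
  rw [sub_self, norm_zero, add_zero] at h1
  refine h1.trans ?_
  gcongr
  exact Finset.single_le_sum (fun i _ => hL0 i) (Finset.mem_univ i)

theorem exists_projection (hh : ∀ i, ContDiff ℝ 1 fun z : E n × E m => h i z.1 z.2) (x : E n)
    (hne : (feas ℓ h x).Nonempty) (y : E m) :
    ∃ w ∈ feas ℓ h x, ∀ z ∈ feas ℓ h x, ‖w - y‖ ≤ ‖z - y‖ := by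
  obtain ⟨w, hw, hd⟩ := (isClosed_feas hh x).exists_infDist_eq_dist hne y
  refine ⟨w, hw, fun z hz => ?_⟩
  rw [← dist_eq_norm, ← dist_eq_norm, dist_comm w, dist_comm z, ← hd]
  exact Metric.infDist_le_dist_of_mem hz

/-! ### From transfer of solutions to the marginal function. -/

theorem marginal_eq_of_mem_solMap {f : E n → E m → ℝ} {x : E n} {y : E m}
    (hy : y ∈ solMap ℓ h f x) : marginal ℓ h f x = (f x y : EReal) :=
  le_antisymm (iInf₂_le y hy.1) (le_iInf₂ fun y' hy' => EReal.coe_le_coe_iff.mpr (hy.2 y' hy'))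

/-- The marginal function is Lipschitz near `xbar` if nearby solutions can be transferred to
feasible points for nearby parameters. -/
theorem locallyLipschitzAt_marginal {f : E n → E m → ℝ} {xbar : E n} {δ L : ℝ} (hδ : 0 < δ)
    (hL : 0 ≤ L)
    (H : ∀ x ∈ Metric.ball xbar δ, ∃ y ∈ solMap ℓ h f x, ∀ x' ∈ Metric.ball xbar δ,
      ∃ w ∈ feas ℓ h x', f x' w ≤ f x y + L * ‖x - x'‖) :
    LocallyLipschitzAt (marginal ℓ h f) xbar := by
  have key : ∀ x ∈ Metric.ball xbar δ, ∀ x' ∈ Metric.ball xbar δ,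
      (marginal ℓ h f x').toReal ≤ (marginal ℓ h f x).toReal + L * ‖x - x'‖ := by
    intro x hx x' hx'
    obtain ⟨y, hy, hy'⟩ := H x hx
    obtain ⟨w, hw, hle⟩ := hy' x' hx'
    obtain ⟨v, hv, -⟩ := H x' hx'
    rw [marginal_eq_of_mem_solMap hy, marginal_eq_of_mem_solMap hv, EReal.toReal_coe,
      EReal.toReal_coe]
    exact (hv.2 w hw).trans hle
  refine ⟨δ, hδ, L + 1, by linarith, fun x hx => ?_, fun x hx x' hx' => ?_⟩
  · obtain ⟨y, hy, -⟩ := H x hx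
    rw [marginal_eq_of_mem_solMap hy]
    exact ⟨EReal.coe_ne_bot _, EReal.coe_ne_top _⟩
  · have h1 := key x hx x' hx'
    have h2 := key x' hx' x hx
    rw [norm_sub_rev x' x] at h2
    rw [abs_le]
    constructor <;> nlinarith [norm_nonneg (x - x')]

/-! ### The inner semicontinuous case. -/

/-- Otherwise parameters without a nearby value would accumulate at `xbar`, and a sequence of them
would contradict the sequential definition. -/
theorem InnerSemicontinuousAt.eventually_exists_dist_lt {Υ : E n → Set (E m)} {xbar : E n}
    {ybar : E m} (hΥ : InnerSemicontinuousAt Υ xbar ybar) {ε : ℝ} (hε : 0 < ε) :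
    ∀ᶠ x in 𝓝 xbar, ∃ y ∈ Υ x, dist y ybar < ε := by
  by_contra hcon
  obtain ⟨x, hx, hno⟩ := exists_seq_forall_of_frequently (not_eventually.mp hcon)
  obtain ⟨y, hy, hmem⟩ := hΥ.2 x hx
  obtain ⟨k, hk1, hk2⟩ := (hmem.and (Metric.tendsto_nhds.mp hy ε hε)).exists
  exact hno k ⟨y k, hk1, hk2⟩

theorem locallyLipschitzAt_marginal_of_innerSemicontinuousAt {f : E n → E m → ℝ}
    (hf : ContDiff ℝ 1 fun z : E n × E m => f z.1 z.2)
    (hh : ∀ i, ContDiff ℝ 1 fun z : E n × E m => h i z.1 z.2) {xbar : E n} {ybar : E m}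
    (hS : InnerSemicontinuousAt (solMap ℓ h f) xbar ybar) (hR : RCPLD ℓ h xbar ybar) :
    LocallyLipschitzAt (marginal ℓ h f) xbar := by
  obtain ⟨M, hM, hmult⟩ := hR.exists_eventually_hasBoundedMultipliers hh hS.1.1
  -- The summand 1 keeps the denominator positive when `p = 0`.
  set η : ℝ := 1 / (2 * (p * M + 1)) with hη
  have hη0 : 0 < η := by positivity
  have hpη : p * M * η ≤ 1 / 2 := by
    rw [hη, mul_one_div, div_le_div_iff₀ (by positivity) two_pos]
    linarith
  have hlin := eventually_all.mpr fun i =>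
    eventually_abs_sub_inner_gradient_le (hh i) xbar ybar hη0
  obtain ⟨ρ₁, hρ₁, hmult⟩ := Metric.eventually_nhds_iff.mp hmult
  obtain ⟨ρ₂, hρ₂, hlin⟩ := Metric.eventually_nhds_iff.mp hlin
  set ρ := min (min ρ₁ ρ₂) 1 with hρ
  have hρ0 : 0 < ρ := lt_min (lt_min hρ₁ hρ₂) one_pos
  have hρ1 : ρ ≤ ρ₁ := (min_le_left _ _).trans (min_le_left _ _)
  have hρ2 : ρ ≤ ρ₂ := (min_le_left _ _).trans (min_le_right _ _)
  have hρ3 : ρ ≤ 1 := min_le_right _ _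
  obtain ⟨δ₁, hδ₁, hsol⟩ := Metric.eventually_nhds_iff.mp
    -- With `y` and `v` within `ρ / 4` of `ybar`, the projection satisfies `dist w y ≤ dist v y < ρ
    -- / 2`, so `w` stays within `ρ`.
    (hS.eventually_exists_dist_lt (show 0 < ρ / 4 by positivity))
  obtain ⟨Lf, hLf, hfL⟩ := exists_lipschitz_bound_on_closedBall hf (xbar, ybar) 1
  obtain ⟨Lh, hLh, hhL⟩ := exists_lipschitz_bound_family hh (xbar, ybar) 1
  refine locallyLipschitzAt_marginal (δ := min δ₁ ρ) (L := Lf * (1 + 2 * p * M * Lh))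
    (lt_min hδ₁ hρ0) (by positivity) fun x hx => ?_
  have hxδ : dist x xbar < δ₁ := lt_of_lt_of_le hx (min_le_left _ _)
  have hxρ : dist x xbar < ρ := lt_of_lt_of_le hx (min_le_right _ _)
  obtain ⟨y, hy, hyd⟩ := hsol hxδ
  refine ⟨y, hy, fun x' hx' => ?_⟩
  have hxδ' : dist x' xbar < δ₁ := lt_of_lt_of_le hx' (min_le_left _ _)
  have hxρ' : dist x' xbar < ρ := lt_of_lt_of_le hx' (min_le_right _ _)
  obtain ⟨v, hv, hvd⟩ := hsol hxδ'
  obtain ⟨w, hw, hmin⟩ := exists_projection hh x' ⟨v, hv.1⟩ y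
  have hwd : dist w ybar < ρ := by
    have h1 : dist w y ≤ dist v y := by
      rw [dist_eq_norm, dist_eq_norm]
      exact hmin v hv.1
    have h2 := dist_triangle w y ybar
    have h3 := dist_triangle_right v y ybar
    linarith
  have hyρ : dist y ybar < ρ := by linarith
  have hball : ∀ {a : E n} {b : E m}, dist a xbar < ρ → dist b ybar < ρ →
      (a, b) ∈ Metric.closedBall (xbar, ybar) 1 := fun ha hb => by
    rw [Metric.mem_closedBall, Prod.dist_eq]
    exact max_le (ha.le.trans hρ3) (hb.le.trans hρ3)
  have hdist : ‖y - w‖ ≤ 2 * p * M * (Lh * ‖x' - x‖) := by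
    refine HasBoundedMultipliers.norm_sub_le hη0.le hM.le hpη (hmult (y := (x', w)) ?_)
      hy.1 hw hmin ?_
      fun i => hhL i x' x y (hball hxρ' hyρ) (hball hxρ hyρ)
    · rw [Prod.dist_eq]
      exact max_lt (hxρ'.trans_le hρ1) (hwd.trans_le hρ1)
    · intro i t _
      have h1 := hlin (y := (x', y, w)) (by
        rw [Prod.dist_eq, Prod.dist_eq]
        exact max_lt (hxρ'.trans_le hρ2) (max_lt (hyρ.trans_le hρ2) (hwd.trans_le hρ2))) i
      dsimp only at h1
      have h2 := mul_le_mul_of_nonneg_left h1 (abs_nonneg t)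
      rw [← abs_mul] at h2
      have h3 := (abs_le.mp h2).1
      linarith
  refine ⟨w, hw, ?_⟩
  have h4 := (abs_le.mp (hfL x' x w y (hball hxρ' hwd) (hball hxρ hyρ))).2
  rw [norm_sub_rev x' x] at h4 hdist
  rw [norm_sub_rev w y] at h4
  have h5 := mul_le_mul_of_nonneg_left hdist hLf
  linarith

/-! ### The convex case. -/

/-- If RCPLD holds on `{xbar} × Γ(xbar)`, multipliers are uniformly bounded at the points of `Γ(x)` in
a compact set, for all `x` near `xbar`. -/
theorem exists_eventually_forall_hasBoundedMultipliers
    (hh : ∀ i, ContDiff ℝ 1 fun z : E n × E m => h i z.1 z.2) {xbar : E n}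
    (hR : ∀ y ∈ feas ℓ h xbar, RCPLD ℓ h xbar y) {C : Set (E m)} (hC : IsCompact C) :
    ∃ M : ℝ, 0 < M ∧ ∀ᶠ x in 𝓝 xbar, ∀ w ∈ C, HasBoundedMultipliers ℓ h M x w := by
  have hmono : ∀ {M M' : ℝ} {x : E n} {w : E m}, M ≤ M' → HasBoundedMultipliers ℓ h M x w →
      HasBoundedMultipliers ℓ h M' x w := by
    intro M M' x w hle hm u hw hmin
    obtain ⟨c, h1, h2, h3, h4⟩ := hm u hw hmin
    exact ⟨c, h1, h2, h3, fun i => (h4 i).trans (by gcongr)⟩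
  refine hC.induction_on
    (p := fun s => ∃ M : ℝ, 0 < M ∧ ∀ᶠ x in 𝓝 xbar, ∀ w ∈ s, HasBoundedMultipliers ℓ h M x w)
    ⟨1, one_pos, by simp⟩ ?_ ?_ ?_
  · rintro s t hst ⟨M, hM, hev⟩
    exact ⟨M, hM, hev.mono fun x hx w hw => hx w (hst hw)⟩
  · rintro s t ⟨M, hM, hev⟩ ⟨M', hM', hev'⟩
    refine ⟨max M M', lt_max_of_lt_left hM, ?_⟩
    filter_upwards [hev, hev'] with x hx hx' w hw
    rcases hw with hw | hw
    · exact hmono (le_max_left _ _) (hx w hw)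
    · exact hmono (le_max_right _ _) (hx' w hw)
  · intro w _
    obtain ⟨M, hM, hev⟩ : ∃ M : ℝ, 0 < M ∧ ∀ᶠ z : E n × E m in 𝓝 (xbar, w),
        HasBoundedMultipliers ℓ h M z.1 z.2 := by
      by_cases hw : w ∈ feas ℓ h xbar
      · exact (hR w hw).exists_eventually_hasBoundedMultipliers hh hw
      -- The graph of `Γ` is closed, so points near an infeasible pair are infeasible and the
      -- multiplier property is vacuous there.
      · refine ⟨1, one_pos, ?_⟩
        have hopen : ∀ᶠ z : E n × E m in 𝓝 (xbar, w), z.2 ∉ feas ℓ h z.1 :=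
          (isClosed_graph_feas hh).isOpen_compl.mem_nhds hw
        exact hopen.mono fun z hz u hz' => absurd hz' hz
    rw [nhds_prod_eq] at hev
    obtain ⟨P, hP, Q, hQ, hPQ⟩ := eventually_prod_iff.mp hev
    exact ⟨{y | Q y}, mem_nhdsWithin_of_mem_nhds hQ, M, hM, hP.mono fun x hx y hy => hPQ hx hy⟩

theorem locallyLipschitzAt_marginal_of_convexAffine {f : E n → E m → ℝ}
    (hf : ContDiff ℝ 1 fun z : E n × E m => f z.1 z.2)
    (hh : ∀ i, ContDiff ℝ 1 fun z : E n × E m => h i z.1 z.2) {xbar : E n}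
    (hconv : ConvexAffine ℓ h) (hbdd : LocallyBoundedAt (feas ℓ h) xbar)
    (hR : ∀ y ∈ feas ℓ h xbar, RCPLD ℓ h xbar y) (hint : xbar ∈ interior (dom (feas ℓ h))) :
    LocallyLipschitzAt (marginal ℓ h f) xbar := by
  obtain ⟨B, hB, V, hV, hVB⟩ := hbdd
  obtain ⟨R₀, hBR₀⟩ := hB.subset_closedBall 0
  -- `R` must bound `B` and also the parameter distance, which is below 1.
  set R := max R₀ 1 with hRdef
  have hBR : B ⊆ Metric.closedBall 0 R :=
    hBR₀.trans (Metric.closedBall_subset_closedBall (le_max_left _ _))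
  obtain ⟨M, hM, hmult⟩ := exists_eventually_forall_hasBoundedMultipliers hh hR
    (isCompact_closedBall (0 : E m) R)
  have hdom : ∀ᶠ x in 𝓝 xbar, (feas ℓ h x).Nonempty := mem_interior_iff_mem_nhds.mp hint
  obtain ⟨δ₁, hδ₁, hev⟩ := Metric.eventually_nhds_iff.mp ((hmult.and hdom).and hV)
  obtain ⟨Lf, hLf, hfL⟩ := exists_lipschitz_bound_on_closedBall hf (xbar, 0) R
  obtain ⟨Lh, hLh, hhL⟩ := exists_lipschitz_bound_family hh (xbar, 0) R
  refine locallyLipschitzAt_marginal (δ := min δ₁ 1) (L := Lf * (1 + 2 * p * M * Lh))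
    (lt_min hδ₁ one_pos) (by positivity) fun x hx => ?_
  obtain ⟨⟨-, hne⟩, hxV⟩ := hev (lt_of_lt_of_le hx (min_le_left _ _))
  have hcomp : IsCompact (feas ℓ h x) := Metric.isCompact_of_isClosed_isBounded
    (isClosed_feas hh x) (hB.subset (hVB x hxV))
  obtain ⟨y, hy, hymin⟩ := hcomp.exists_isMinOn hne (f := f x)
    (hf.continuous.comp (Continuous.prodMk_right x)).continuousOn
  refine ⟨y, ⟨hy, fun y' hy' => hymin hy'⟩, fun x' hx' => ?_⟩
  obtain ⟨⟨hmult', hne'⟩, hxV'⟩ := hev (lt_of_lt_of_le hx' (min_le_left _ _))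
  obtain ⟨w, hw, hmin⟩ := exists_projection hh x' hne' y
  have hball : ∀ {a : E n} {b : E m}, a ∈ Metric.ball xbar (min δ₁ 1) → b ∈ B →
      (a, b) ∈ Metric.closedBall (xbar, (0 : E m)) R := fun ha hb => by
    rw [Metric.mem_closedBall, Prod.dist_eq]
    exact max_le ((Metric.mem_ball.mp ha).le.trans ((min_le_right _ _).trans (le_max_right _ _)))
      (hBR hb)
  have hyB := hVB x hxV hy
  have hwB := hVB x' hxV' hw
  have hdist : ‖y - w‖ ≤ 2 * p * M * (Lh * ‖x' - x‖) :=
    -- Here `η = 0`: the linearization inequality is global, so `y` and `w` need not be close to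
    -- each other beforehand.
    HasBoundedMultipliers.norm_sub_le le_rfl hM.le (by norm_num) (hmult' w (hBR hwB)) hy hw hmin
      (fun i t ht => by simpa using hconv.mul_inner_gradient_le hh x' y w i t ht)
      fun i => hhL i x' x y (hball hx' hyB) (hball hx hyB)
  refine ⟨w, hw, ?_⟩
  have h4 := (abs_le.mp (hfL x' x w y (hball hx' hwB) (hball hx hyB))).2
  rw [norm_sub_rev x' x] at h4 hdist
  rw [norm_sub_rev w y] at h4
  have h5 := mul_le_mul_of_nonneg_left hdist hLf
  linarith

end ParamOpt

theorem mainTheorem7 {n m p ℓ : ℕ} (hℓ : ℓ ≤ p)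
    (f : ParamOpt.E n → ParamOpt.E m → ℝ)
    (h : Fin p → ParamOpt.E n → ParamOpt.E m → ℝ)
    (hf : ContDiff ℝ 1 (fun z : ParamOpt.E n × ParamOpt.E m => f z.1 z.2))
    (hh : ∀ i, ContDiff ℝ 1 (fun z : ParamOpt.E n × ParamOpt.E m => h i z.1 z.2))
    (xbar : ParamOpt.E n) (hxbar : xbar ∈ ParamOpt.dom (ParamOpt.feas ℓ h))
    (hcases :
      (ParamOpt.ConvexAffine ℓ h ∧
        ParamOpt.LocallyBoundedAt (ParamOpt.feas ℓ h) xbar ∧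
        (∀ y ∈ ParamOpt.feas ℓ h xbar, ParamOpt.RCPLD ℓ h xbar y) ∧
        xbar ∈ interior (ParamOpt.dom (ParamOpt.feas ℓ h))) ∨
      (∃ ybar ∈ ParamOpt.solMap ℓ h f xbar,
        ParamOpt.InnerSemicontinuousAt (ParamOpt.solMap ℓ h f) xbar ybar ∧
        ParamOpt.RCPLD ℓ h xbar ybar)) :
    ParamOpt.LocallyLipschitzAt (ParamOpt.marginal ℓ h f) xbar := by
  rcases hcases with ⟨hconv, hbdd, hR, hint⟩ | ⟨ybar, -, hS, hR⟩
  · exact ParamOpt.locallyLipschitzAt_marginal_of_convexAffine hf hh hconv hbdd hR hint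
  · exact ParamOpt.locallyLipschitzAt_marginal_of_innerSemicontinuousAt hf hh hS hR
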